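/- **Theorem (Robustness Guarantee).** Let $\mathcal X\subset\mathbb R^m$, $\mathcal Y\subset\mathbb R$, $\mathcal Z=\mathcal X\times\mathcal Y$, let $w\in[1,\infty)^m$, and let $$c_w\big((x,y),(x',y')\big)=\|w\odot(x-x')\|_2^2+\infty\cdot\mathbb I(y\ne y')\qquad(0\cdot\infty=0).$$ For probability measures $P,Q$ on $\mathcal Z$ put $W_{c_w}(P,Q)=\inf_{M}\mathbb E_{(z,z')\sim M}[c_w(z,z')]$, the infimum being over all couplings $M$ of $P$ and $Q$. Let $\Theta=\mathbb R^d$, let $F$ be a class of prediction functions $\mathcal X\to\mathbb R$ containing the predictors $f_\theta$, $\theta\in\Theta$, let $\ell(u,y)$ be the loss of the prediction $u$ at the label $y$, and write $\ell(\theta;(x,y))=\ell(f_\theta(x),y)$. Assume that $\ell(\theta;z)$ is continuous on $\Theta\times\mathcal Z$ and that $|\ell(\theta;z)|\le T_\ell$ for all $\theta\in\Theta$, $z\in\mathcal Z$, where $T_\ell\ge 0$. For $\lambda\ge0$ let $$s_\lambda(\theta;z)=\sup_{\xi\in\mathcal Z}\{\ell(\theta;\xi)-\lambda c_w(\xi,z)\},\qquad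 \widetilde\ell\circ F=\{(x,y)\mapsto \ell(f(x),y)-\ell(0,y): f\in F\}.$$ Let $P_0$ be a probability measure on $\mathcal Z$, let $\hat P_n$ be the empirical distribution of $n\ge1$ i.i.d. samples $z_1,\dots,z_n$ from $P_0$, and let $\mathcal R_n(\mathcal G)=\mathbb E_{z}\,\mathbb E_\sigma\big[\sup_{g\in\mathcal G}\frac1n\sum_{i=1}^n\sigma_i g(z_i)\big]$, with $\sigma$ uniform on $\{-1,1\}^n$, be the Rademacher complexity. There is a numerical constant $k\ge0$ (independent of all the data above) such that, for every $\delta\in(0,1)$: 1. For all $\theta\in\Theta$, $\rho\ge0$, $\lambda\ge0$, with probability at least $1-\delta$, $$\sup_{P:\,W_{c_w}(P,P_0)\le\rho}\mathbb E_P[\ell(\theta;Z)]\le\lambda\rho+\mathbb E_{\hat P_n}[s_\lambda(\theta;Z)]+\mathcal R_n(\widetilde\ell\circ F)+kT_\ell\sqrt{\ln(1/\delta)/n}.$$ 2. For all $\theta\in\Theta$, $\lambda\ge0$, and every map $M(\theta;\cdot):\mathcal Z\to\mathcal Z$ with $M(\theta;z_0)\in\arg\max_{\xi\in\mathcal Z}\{\ell(\theta;\xi)-\lambda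 c_w(\xi,z_0)\}$ for all $z_0\in\mathcal Z$, put $\hat\rho_n(\theta)=\mathbb E_{\hat P_n}[c_w(M(\theta;Z),Z)]$. Then, with probability at least $1-\delta$, $$\sup_{P:\,W_{c_w}(P,P_0)\le\hat\rho_n(\theta)}\mathbb E_P[\ell(\theta;Z)]\le\sup_{P:\,W_{c_w}(P,\hat P_n)\le\hat\rho_n(\theta)}\mathbb E_P[\ell(\theta;Z)]+\mathcal R_n(\widetilde\ell\circ F)+kT_\ell\sqrt{\ln(1/\delta)/n}.$$ -/

import Mathlib

open MeasureTheory
open scoped ENNReal NNReal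

namespace RobustRisk

noncomputable section

/-- The event `A` contains a measurable event of probability at least `p`. -/
def HoldsWithProb {Ω : Type*} [MeasurableSpace Ω] (μ : Measure Ω) (p : ℝ) (A : Set Ω) : Prop :=
  ∃ S : Set Ω, MeasurableSet S ∧ S ⊆ A ∧ ENNReal.ofReal p ≤ μ S

/-- Couplings of `P` and `Q`: measures on the product with marginals `P` and `Q`. -/
def couplings {Z : Type*} [MeasurableSpace Z] (P Q : Measure Z) : Set (Measure (Z × Z)) :=
  {M | M.fst = P ∧ M.snd = Q}

/-- The Wasserstein distance `W_c(P, Q)`: the infimum over couplings of the expected cost. -/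
def wasserstein {Z : Type*} [MeasurableSpace Z] (c : Z → Z → ℝ≥0∞) (P Q : Measure Z) : ℝ≥0∞ :=
  ⨅ M ∈ couplings P Q, ∫⁻ q, c q.1 q.2 ∂M

/-- `sup { E_P[loss] : P a probability measure on Z with W_c(P, P₀) ≤ ρ }`, in the extended reals. -/
def worstRisk {Z : Type*} [MeasurableSpace Z] (c : Z → Z → ℝ≥0∞) (loss : Z → ℝ) (ρ : ℝ≥0∞)
    (P₀ : Measure Z) : EReal :=
  ⨆ P : ProbabilityMeasure Z, ⨆ _ : wasserstein c (P : Measure Z) P₀ ≤ ρ,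
    ((∫ z, loss z ∂(P : Measure Z) : ℝ) : EReal)

/-- `loss ξ - lam * c ξ z₀` in the extended reals (with `0 * ∞ = 0`). -/
def penalized {Z : Type*} (c : Z → Z → ℝ≥0∞) (loss : Z → ℝ) (lam : ℝ≥0) (ξ z₀ : Z) : EReal :=
  (loss ξ : EReal) - (((lam : ℝ≥0∞) * c ξ z₀ : ℝ≥0∞) : EReal)

/-- The robust surrogate `s_λ(z₀) = sup_ξ (loss ξ - lam * c ξ z₀)`. For a loss with values in
`[-T, T]` and a cost with `c z z = 0` the supremum lies in `[-T, T]`, so `toReal` is harmless. -/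
def surrogate {Z : Type*} (c : Z → Z → ℝ≥0∞) (loss : Z → ℝ) (lam : ℝ≥0) (z₀ : Z) : ℝ :=
  (⨆ ξ : Z, penalized c loss lam ξ z₀).toReal

/-- The empirical distribution of a sample `z₁, …, zₙ`. -/
def empirical {Z : Type*} [MeasurableSpace Z] {n : ℕ} (z : Fin n → Z) : Measure Z :=
  (n : ℝ≥0∞)⁻¹ • ∑ i, Measure.dirac (z i)

/-- The empirical Rademacher complexity `E_σ[sup_{g ∈ G} (1/n) ∑ᵢ σᵢ g(zᵢ)]`, the signs
`σ` being uniform on `{-1, 1}ⁿ`. -/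
def empiricalRademacher {Z : Type*} {n : ℕ} (G : Set (Z → ℝ)) (z : Fin n → Z) : EReal :=
  ((((2 : ℝ) ^ n)⁻¹ : ℝ) : EReal) *
    ∑ σ : Fin n → ℤˣ, ⨆ g ∈ G, (((1 / n : ℝ) * ∑ i, ((σ i : ℤ) : ℝ) * g (z i) : ℝ) : EReal)

/-- The Rademacher complexity `Rₙ(G)`: the expectation of the empirical Rademacher complexity over
an i.i.d. sample of size `n` from `P₀`. The integrand is nonnegative as soon as `G` is nonempty. -/
def rademacher {Z : Type*} [MeasurableSpace Z] (P₀ : Measure Z) (n : ℕ) (G : Set (Z → ℝ)) : ℝ≥0∞ :=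
  ∫⁻ z : Fin n → Z, (empiricalRademacher G z).toENNReal ∂(Measure.pi fun _ => P₀)

/-- The cost `c_w((x, y), (x', y')) = ‖w ⊙ (x - x')‖₂² + ∞ · 1(y ≠ y')` on `X × Y`. -/
def weightedCost {m : ℕ} {X : Set (EuclideanSpace ℝ (Fin m))} {Y : Set ℝ} (w : Fin m → ℝ)
    (z z' : X × Y) : ℝ≥0∞ :=
  ENNReal.ofReal (∑ i, (w i * ((z.1 : EuclideanSpace ℝ (Fin m)) i
      - (z'.1 : EuclideanSpace ℝ (Fin m)) i)) ^ 2)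
    + if z.2 = z'.2 then 0 else ∞

/-- The loss `(x, y) ↦ ℓ(f(x), y)` of a prediction function `f`. -/
def predictionLoss {m : ℕ} {X : Set (EuclideanSpace ℝ (Fin m))} {Y : Set ℝ} (ℓ : ℝ → ℝ → ℝ)
    (f : X → ℝ) (z : X × Y) : ℝ :=
  ℓ (f z.1) z.2

/-- The class `{(x, y) ↦ ℓ(f(x), y) - ℓ(0, y) : f ∈ F}`. -/
def shiftedLossClass {m : ℕ} {X : Set (EuclideanSpace ℝ (Fin m))} {Y : Set ℝ} (ℓ : ℝ → ℝ → ℝ)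
    (F : Set (X → ℝ)) : Set (X × Y → ℝ) :=
  (fun f z => ℓ (f z.1) z.2 - ℓ 0 z.2) '' F

end

end RobustRisk

namespace RobustRisk

/-! ### Pointwise duality for the surrogate. -/

variable {Z : Type*}

/-! By definition of the surrogate, `loss ξ ≤ s_λ z + λ c(ξ, z)`. Integrating this along
near-optimal couplings gives weak duality, `worstRisk ≤ λρ + E_{P₀}[s_λ]`, for every radius at once
(`worstRisk_le`). With θ and λ fixed, `s_λ` is a single function with values in `[-T, T]`, so
Hoeffding's inequality replaces `P₀` by the empirical distribution at cost `√2 T √(ln(1/δ)/n)`. No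
uniform bound over a class is needed, and the Rademacher term enters only as a nonnegative summand.
For the data-dependent radius, moving each sample point to its maximizer yields a measure in the
empirical ball whose risk equals the empirical dual value (`le_worstRisk_empirical`). -/

theorem iSup_penalized_bounds {c : Z → Z → ℝ≥0∞} {loss : Z → ℝ} {T : ℝ}
    (hc : ∀ z, c z z = 0) (hT : ∀ z, |loss z| ≤ T) (lam : ℝ≥0) (z₀ : Z) :
    (-T : ℝ) ≤ ⨆ ξ, penalized c loss lam ξ z₀ ∧
      ⨆ ξ, penalized c loss lam ξ z₀ ≤ (T : EReal) := by
  constructor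
  · refine le_trans ?_ (le_iSup _ z₀)
    simp only [penalized, hc, mul_zero, EReal.coe_ennreal_zero, sub_zero]
    exact EReal.coe_le_coe_iff.2 (abs_le.1 (hT z₀)).1
  · refine iSup_le fun ξ => ?_
    have h0 : (0 : EReal) ≤ (((lam : ℝ≥0∞) * c ξ z₀ : ℝ≥0∞) : EReal) := EReal.coe_ennreal_nonneg _
    calc penalized c loss lam ξ z₀ ≤ (loss ξ : EReal) - 0 := EReal.sub_le_sub le_rfl h0
      _ ≤ T := by
        rw [sub_zero]; exact EReal.coe_le_coe_iff.2 (abs_le.1 (hT ξ)).2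

/-- For a bounded loss the supremum defining the surrogate is finite. -/
theorem coe_surrogate {c : Z → Z → ℝ≥0∞} {loss : Z → ℝ} {T : ℝ}
    (hc : ∀ z, c z z = 0) (hT : ∀ z, |loss z| ≤ T) (lam : ℝ≥0) (z₀ : Z) :
    (surrogate c loss lam z₀ : EReal) = ⨆ ξ, penalized c loss lam ξ z₀ := by
  obtain ⟨h1, h2⟩ := iSup_penalized_bounds hc hT lam z₀
  exact EReal.coe_toReal (ne_top_of_le_ne_top (EReal.coe_ne_top _) h2)
    (ne_bot_of_le_ne_bot (EReal.coe_ne_bot _) h1)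

theorem surrogate_mem_Icc {c : Z → Z → ℝ≥0∞} {loss : Z → ℝ} {T : ℝ}
    (hc : ∀ z, c z z = 0) (hT : ∀ z, |loss z| ≤ T) (lam : ℝ≥0) (z₀ : Z) :
    surrogate c loss lam z₀ ∈ Set.Icc (-T) T := by
  obtain ⟨h1, h2⟩ := iSup_penalized_bounds hc hT lam z₀
  rw [← coe_surrogate hc hT] at h1 h2
  exact ⟨EReal.coe_le_coe_iff.1 h1, EReal.coe_le_coe_iff.1 h2⟩

theorem penalized_eq_coe {c : Z → Z → ℝ≥0∞} (loss : Z → ℝ) {lam : ℝ≥0} {ξ z₀ : Z}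
    (h : (lam : ℝ≥0∞) * c ξ z₀ ≠ ∞) :
    penalized c loss lam ξ z₀ = ((loss ξ - lam * (c ξ z₀).toReal : ℝ) : EReal) := by
  have h2 : (((lam : ℝ≥0∞) * c ξ z₀ : ℝ≥0∞) : EReal) = ((lam * (c ξ z₀).toReal : ℝ) : EReal) := by
    rw [← EReal.coe_ennreal_toReal h, ENNReal.toReal_mul, ENNReal.coe_toReal]
  rw [penalized, h2, EReal.coe_sub]

theorem loss_le_surrogate_add {c : Z → Z → ℝ≥0∞} {loss : Z → ℝ} {T : ℝ}
    (hc : ∀ z, c z z = 0) (hT : ∀ z, |loss z| ≤ T) (lam : ℝ≥0) {ξ z₀ : Z} (h : c ξ z₀ ≠ ∞) :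
    loss ξ ≤ surrogate c loss lam z₀ + lam * (c ξ z₀).toReal := by
  have h1 := le_iSup (fun ξ => penalized c loss lam ξ z₀) ξ
  rw [← coe_surrogate hc hT] at h1
  simp only [penalized_eq_coe loss (ENNReal.mul_ne_top ENNReal.coe_ne_top h)] at h1
  linarith [EReal.coe_le_coe_iff.1 h1]

theorem surrogate_add_eq_loss {c : Z → Z → ℝ≥0∞} {loss : Z → ℝ} {T : ℝ}
    (hc : ∀ z, c z z = 0) (hT : ∀ z, |loss z| ≤ T) {lam : ℝ≥0} {ξ₀ z₀ : Z} (h : c ξ₀ z₀ ≠ ∞)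
    (hmax : ∀ ξ, penalized c loss lam ξ z₀ ≤ penalized c loss lam ξ₀ z₀) :
    surrogate c loss lam z₀ + lam * (c ξ₀ z₀).toReal = loss ξ₀ := by
  have h1 : ⨆ ξ, penalized c loss lam ξ z₀ = penalized c loss lam ξ₀ z₀ :=
    le_antisymm (iSup_le hmax) (le_iSup (fun ξ => penalized c loss lam ξ z₀) ξ₀)
  rw [← coe_surrogate hc hT,
    penalized_eq_coe loss (ENNReal.mul_ne_top ENNReal.coe_ne_top h), EReal.coe_eq_coe_iff] at h1
  linarith

section Measure

variable [MeasurableSpace Z]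

/-! ### Weak duality. -/

theorem integral_loss_le_of_coupling {c : Z → Z → ℝ≥0∞} {loss : Z → ℝ} {T : ℝ} {lam : ℝ≥0}
    (hc : ∀ z, c z z = 0) (hT : ∀ z, |loss z| ≤ T) (hcm : Measurable fun q : Z × Z => c q.1 q.2)
    (hl : Measurable loss) (hs : Measurable (surrogate c loss lam))
    {P Q : Measure Z} [IsProbabilityMeasure Q] {M : Measure (Z × Z)} (hM : M ∈ couplings P Q)
    (hfin : ∫⁻ q, c q.1 q.2 ∂M ≠ ∞) :
    ∫ z, loss z ∂P ≤ ∫ z, surrogate c loss lam z ∂Q + lam * (∫⁻ q, c q.1 q.2 ∂M).toReal := by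
  obtain ⟨rfl, rfl⟩ := hM
  have : IsProbabilityMeasure M := ⟨by
    rw [← Measure.snd_univ]; exact measure_univ⟩
  have hae : ∀ᵐ q ∂M, c q.1 q.2 < ∞ := ae_lt_top hcm hfin
  have hil : Integrable (fun q : Z × Z => loss q.1) M :=
    Integrable.of_bound (hl.comp measurable_fst).aestronglyMeasurable T
      (ae_of_all _ fun q => hT q.1)
  have his : Integrable (fun q : Z × Z => surrogate c loss lam q.2) M :=
    Integrable.of_bound (hs.comp measurable_snd).aestronglyMeasurable T
      (ae_of_all _ fun q => abs_le.2 (surrogate_mem_Icc hc hT lam q.2))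
  have hic : Integrable (fun q : Z × Z => (c q.1 q.2).toReal) M :=
    integrable_toReal_of_lintegral_ne_top hcm.aemeasurable hfin
  rw [Measure.fst, Measure.snd, integral_map measurable_fst.aemeasurable hl.aestronglyMeasurable,
    integral_map measurable_snd.aemeasurable hs.aestronglyMeasurable,
    ← integral_toReal hcm.aemeasurable hae, ← integral_const_mul,
    ← integral_add his (hic.const_mul _)]
  refine integral_mono_ae hil (his.add (hic.const_mul _)) ?_
  filter_upwards [hae] with q hq
  exact loss_le_surrogate_add hc hT lam hq.ne

/-- Weak duality for the worst-case risk over a Wasserstein ball. -/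
theorem worstRisk_le {c : Z → Z → ℝ≥0∞} {loss : Z → ℝ} {T : ℝ} {lam : ℝ≥0}
    (hc : ∀ z, c z z = 0) (hT : ∀ z, |loss z| ≤ T) (hcm : Measurable fun q : Z × Z => c q.1 q.2)
    (hl : Measurable loss) (hs : Measurable (surrogate c loss lam))
    (Q : Measure Z) [IsProbabilityMeasure Q] (ρ : ℝ≥0) :
    worstRisk c loss ρ Q ≤ ((lam * ρ + ∫ z, surrogate c loss lam z ∂Q : ℝ) : EReal) := by
  refine iSup₂_le fun P hP => EReal.coe_le_coe_iff.2 ?_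
  -- The infimum over couplings need not be attained, so slack `ε` is allowed in the transport cost.
  have key : ∀ ε : ℝ≥0, 0 < ε →
      ∫ z, loss z ∂(P : Measure Z) ≤ lam * (ρ + ε) + ∫ z, surrogate c loss lam z ∂Q := by
    intro ε hε
    have hlt : wasserstein c (P : Measure Z) Q < ((ρ + ε : ℝ≥0) : ℝ≥0∞) :=
      hP.trans_lt (ENNReal.coe_lt_coe.2 (lt_add_of_pos_right ρ hε))
    obtain ⟨M, hlt⟩ := iInf_lt_iff.1 hlt
    obtain ⟨hM, hlt⟩ := iInf_lt_iff.1 hlt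
    have h1 := integral_loss_le_of_coupling (lam := lam) hc hT hcm hl hs hM
      (hlt.trans ENNReal.coe_lt_top).ne
    have h2 := ENNReal.toReal_mono ENNReal.coe_ne_top hlt.le
    rw [ENNReal.coe_toReal, NNReal.coe_add] at h2
    have h3 := mul_le_mul_of_nonneg_left h2 lam.coe_nonneg
    linarith
  refine le_of_forall_pos_le_add fun ε hε => ?_
  -- Dividing by `lam + 1` rather than `lam` also covers `lam = 0`.
  have hpos : (0 : ℝ) < lam + 1 := by positivity
  have h := key (ε / (lam + 1)).toNNReal (Real.toNNReal_pos.2 (div_pos hε hpos))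
  have h4 : (lam : ℝ) * (ε / (lam + 1)) ≤ ε := by
    rw [← mul_div_assoc, div_le_iff₀ hpos]; nlinarith [lam.coe_nonneg]
  rw [Real.coe_toNNReal _ (div_pos hε hpos).le] at h
  linarith

/-! ### Empirical measures and attainment of the dual value. -/

theorem isProbabilityMeasure_empirical {n : ℕ} (hn : 0 < n) (z : Fin n → Z) :
    IsProbabilityMeasure (empirical z) := ⟨by
  simp [empirical, ENNReal.inv_mul_cancel, hn.ne']⟩

theorem integral_empirical [MeasurableSingletonClass Z] {n : ℕ} (g : Z → ℝ) (z : Fin n → Z) :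
    ∫ ζ, g ζ ∂(empirical z) = (n : ℝ)⁻¹ * ∑ i, g (z i) := by
  rw [empirical, integral_smul_measure, integral_finsetSum_measure]
  · simp
  · intro i _
    exact integrable_dirac (by simp)

theorem lintegral_empirical [MeasurableSingletonClass Z] {n : ℕ} (g : Z → ℝ≥0∞) (z : Fin n → Z) :
    ∫⁻ ζ, g ζ ∂(empirical z) = (n : ℝ≥0∞)⁻¹ * ∑ i, g (z i) := by
  simp [empirical, lintegral_finsetSum_measure]

theorem map_empirical {W : Type*} [MeasurableSpace W] {n : ℕ} {g : Z → W} (hg : Measurable g)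
    (z : Fin n → Z) : (empirical z).map g = empirical (g ∘ z) := by
  rw [empirical, empirical, Measure.map_smul, Measure.map_finset_sum hg.aemeasurable]
  simp [Measure.map_dirac' hg]

/-- The coupling puts mass `1/n` on each pair `(M (z i), z i)`. Working with `empirical (M ∘ z)`
instead of a pushforward avoids measurability of `M`. -/
theorem wasserstein_empirical_le [MeasurableSingletonClass Z] {n : ℕ} (c : Z → Z → ℝ≥0∞)
    (M : Z → Z) (z : Fin n → Z) :
    wasserstein c (empirical (M ∘ z)) (empirical z) ≤ ∫⁻ ζ, c (M ζ) ζ ∂(empirical z) := by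
  have hmem : empirical (fun i => (M (z i), z i)) ∈ couplings (empirical (M ∘ z)) (empirical z) :=
    ⟨map_empirical measurable_fst _, map_empirical measurable_snd _⟩
  refine (iInf₂_le _ hmem).trans (le_of_eq ?_)
  rw [lintegral_empirical, lintegral_empirical]

/-- The image of the empirical distribution under a maximizer map attains the dual bound. -/
theorem le_worstRisk_empirical [MeasurableSingletonClass Z] {n : ℕ} (hn : 0 < n)
    {c : Z → Z → ℝ≥0∞} {loss : Z → ℝ} {T : ℝ} {lam : ℝ≥0}
    (hc : ∀ z, c z z = 0) (hT : ∀ z, |loss z| ≤ T) (M : Z → Z)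
    (hM : ∀ z₀ ξ, penalized c loss lam ξ z₀ ≤ penalized c loss lam (M z₀) z₀) (z : Fin n → Z)
    (hfin : ∫⁻ ζ, c (M ζ) ζ ∂(empirical z) ≠ ∞) :
    ((lam * (∫⁻ ζ, c (M ζ) ζ ∂(empirical z)).toReal
        + ∫ ζ, surrogate c loss lam ζ ∂(empirical z) : ℝ) : EReal)
      ≤ worstRisk c loss (∫⁻ ζ, c (M ζ) ζ ∂(empirical z)) (empirical z) := by
  have := isProbabilityMeasure_empirical hn (M ∘ z)
  refine le_trans (EReal.coe_le_coe_iff.2 ?_) (le_iSup₂ (f := fun (P : ProbabilityMeasure Z)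
    (_ : wasserstein c (P : Measure Z) (empirical z) ≤ ∫⁻ ζ, c (M ζ) ζ ∂(empirical z)) =>
    ((∫ z, loss z ∂(P : Measure Z) : ℝ) : EReal)) ⟨empirical (M ∘ z), this⟩
    (wasserstein_empirical_le c M z))
  -- One infinite cost would make the whole average infinite, since its weight `1/n` is positive.
  have hi : ∀ i, c (M (z i)) (z i) ≠ ∞ := by
    rw [lintegral_empirical] at hfin
    intro i hi
    refine hfin (ENNReal.mul_eq_top.2 (Or.inl ⟨by simp, ?_⟩))
    exact ENNReal.sum_eq_top.2 ⟨i, Finset.mem_univ i, hi⟩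
  rw [lintegral_empirical, ProbabilityMeasure.coe_mk, integral_empirical, integral_empirical,
    ENNReal.toReal_mul, ENNReal.toReal_sum fun i _ => hi i, ENNReal.toReal_inv,
    ENNReal.toReal_natCast]
  rw [mul_left_comm, ← mul_add, Finset.mul_sum, ← Finset.sum_add_distrib]
  refine le_of_eq ?_
  congr 1
  refine Finset.sum_congr rfl fun i _ => ?_
  rw [Function.comp_apply, ← surrogate_add_eq_loss hc hT (hi i) (hM (z i)), add_comm]

theorem worstRisk_top_eq (c : Z → Z → ℝ≥0∞) (loss : Z → ℝ) (P Q : Measure Z) :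
    worstRisk c loss ∞ P = worstRisk c loss ∞ Q := by
  simp [worstRisk]


/-! ### Concentration. -/

/-- One-sided Hoeffding bound for the empirical mean of a bounded function. -/
theorem holdsWithProb_integral_le_empirical [MeasurableSingletonClass Z] {P : Measure Z}
    [IsProbabilityMeasure P] {g : Z → ℝ} (hg : Measurable g) {T : ℝ} (hT : 0 ≤ T)
    (hb : ∀ z, g z ∈ Set.Icc (-T) T) {n : ℕ} (hn : 0 < n) {δ : ℝ} (hδ : 0 < δ) (hδ1 : δ < 1) :
    HoldsWithProb (Measure.pi fun _ : Fin n => P) (1 - δ)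
      {z | ∫ ζ, g ζ ∂P ≤ ∫ ζ, g ζ ∂(empirical z) + √2 * T * √(Real.log (1 / δ) / n)} := by
  have hn' : (0 : ℝ) < n := Nat.cast_pos.2 hn
  rcases hT.eq_or_lt with rfl | hT
  -- When `T = 0` the variance proxy vanishes and the exponent would divide by zero.
  · have h0 : g = 0 := funext fun z => by simpa using hb z
    exact ⟨Set.univ, MeasurableSet.univ, fun z _ => by simp [h0], by
      rw [measure_univ, ← ENNReal.ofReal_one]; exact ENNReal.ofReal_le_ofReal (by linarith)⟩
  set L := Real.log (1 / δ) with hL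
  have hLpos : 0 < L := Real.log_pos (by rw [lt_div_iff₀ hδ]; linarith)
  -- The solution of `exp (-ε² / (2 n T²)) = δ`, each summand having variance proxy `T²`; this is
  -- the source of `√2`.
  set ε := n * (√2 * T * √(L / n)) with hε
  have hε0 : 0 ≤ ε := by positivity
  set μ := Measure.pi fun _ : Fin n => P with hμ
  have hmeas : ∀ i : Fin n, Measurable fun z : Fin n → Z => g (z i) :=
    fun i => hg.comp (measurable_pi_apply i)
  have hsub : ∀ i : Fin n, ProbabilityTheory.HasSubgaussianMGF
      (fun z : Fin n → Z => ∫ ζ, g ζ ∂P - g (z i)) (‖T - (-T)‖₊ / 2 * (‖T - (-T)‖₊ / 2)) μ := by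
    intro i
    have h := (ProbabilityTheory.hasSubgaussianMGF_of_mem_Icc (μ := μ) (hmeas i).aemeasurable
      (ae_of_all _ fun z => hb (z i))).neg
    rw [integral_comp_eval (μ := fun _ : Fin n => P) (i := i) hg.aestronglyMeasurable, sq] at h
    refine h.congr (ae_of_all _ fun z => ?_)
    simp
  have hindep : ProbabilityTheory.iIndepFun
      (fun (i : Fin n) (z : Fin n → Z) => ∫ ζ, g ζ ∂P - g (z i)) μ :=
    ProbabilityTheory.iIndepFun_pi (X := fun (_ : Fin n) ζ => ∫ ζ, g ζ ∂P - g ζ)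
      fun _ => (measurable_const.sub hg).aemeasurable
  have hoeff := ProbabilityTheory.HasSubgaussianMGF.measure_sum_ge_le_of_iIndepFun hindep
    (s := Finset.univ) (fun i _ => hsub i) hε0
  have hexp : Real.exp (-ε ^ 2 / (2 * ((∑ _i : Fin n, ‖T - (-T)‖₊ / 2 * (‖T - (-T)‖₊ / 2) : ℝ≥0) : ℝ)))
      = δ := by
    have h1 : ((∑ _i : Fin n, ‖T - (-T)‖₊ / 2 * (‖T - (-T)‖₊ / 2) : ℝ≥0) : ℝ) = n * T ^ 2 := by
      rw [sub_neg_eq_add, ← two_mul]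
      simp only [Finset.sum_const, Finset.card_univ, Fintype.card_fin, NNReal.coe_natCast,
        NNReal.coe_mul, NNReal.coe_div, coe_nnnorm, NNReal.coe_ofNat, nsmul_eq_mul, norm_mul,
        Real.norm_ofNat, Real.norm_of_nonneg hT.le]
      ring
    have h2 : ε ^ 2 = 2 * n * T ^ 2 * L := by
      rw [hε, mul_pow, mul_pow, mul_pow, Real.sq_sqrt (by norm_num), Real.sq_sqrt (by positivity)]
      field_simp
    have h3 : -ε ^ 2 / (2 * (n * T ^ 2)) = -L := by
      rw [h2]; field_simp
    rw [h1, h3, hL, one_div, Real.log_inv, neg_neg, Real.exp_log hδ]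
  have hB : MeasurableSet {z : Fin n → Z | ε ≤ ∑ i, (∫ ζ, g ζ ∂P - g (z i))} :=
    measurableSet_le measurable_const
      (Finset.measurable_sum _ fun i _ => measurable_const.sub (hmeas i))
  refine ⟨_, hB.compl, fun z hz => ?_, ?_⟩
  · have hz' : ∑ i, (∫ ζ, g ζ ∂P - g (z i)) < ε := not_le.1 hz
    rw [Finset.sum_sub_distrib, Finset.sum_const, Finset.card_univ, Fintype.card_fin,
      nsmul_eq_mul, hε] at hz'
    rw [Set.mem_ofPred_eq, integral_empirical, ← mul_le_mul_iff_right₀ hn', mul_add,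
      mul_inv_cancel_left₀ hn'.ne']
    linarith
  · rw [← ENNReal.ofReal_toReal (measure_ne_top μ _)]
    refine ENNReal.ofReal_le_ofReal ?_
    change 1 - δ ≤ μ.real _
    rw [probReal_compl_eq_one_sub hB]
    rw [hexp] at hoeff
    linarith

end Measure

section WeightedCost

/-! ### The weighted cost and measurability of its surrogate. -/

variable {m : ℕ} {X : Set (EuclideanSpace ℝ (Fin m))} {Y : Set ℝ}

theorem weightedCost_self (w : Fin m → ℝ) (z : X × Y) : weightedCost w z z = 0 := by
  simp [weightedCost]

theorem measurable_weightedCost (w : Fin m → ℝ) :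
    Measurable fun q : (X × Y) × (X × Y) => weightedCost w q.1 q.2 := by
  unfold weightedCost
  refine Measurable.add (M := ℝ≥0∞) ?_ (Measurable.ite ?_ measurable_const measurable_const)
  · refine (ENNReal.continuous_ofReal.comp ?_).measurable
    fun_prop
  · exact measurableSet_eq_fun (measurable_snd.comp measurable_fst)
      (measurable_snd.comp measurable_snd)

/-- With a positive multiplier, the supremum can be restricted to points with the same label. -/
theorem iSup_penalized_weightedCost (w : Fin m → ℝ) (loss : X × Y → ℝ) {lam : ℝ≥0}
    (hlam : lam ≠ 0) (z : X × Y) :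
    ⨆ ξ, penalized (weightedCost w) loss lam ξ z
      = ⨆ x : X, ((loss (x, z.2) - lam * ∑ i, (w i * ((x : EuclideanSpace ℝ (Fin m)) i
          - (z.1 : EuclideanSpace ℝ (Fin m)) i)) ^ 2 : ℝ) : EReal) := by
  have hval : ∀ x : X, penalized (weightedCost w) loss lam (x, z.2) z
      = ((loss (x, z.2) - lam * ∑ i, (w i * ((x : EuclideanSpace ℝ (Fin m)) i
          - (z.1 : EuclideanSpace ℝ (Fin m)) i)) ^ 2 : ℝ) : EReal) := by
    intro x
    have hc : weightedCost w (x, z.2) z = ENNReal.ofReal (∑ i,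
        (w i * ((x : EuclideanSpace ℝ (Fin m)) i - (z.1 : EuclideanSpace ℝ (Fin m)) i)) ^ 2) := by
      simp [weightedCost]
    have hfin : (lam : ℝ≥0∞) * weightedCost w (x, z.2) z ≠ ∞ := by
      rw [hc]; exact ENNReal.mul_ne_top ENNReal.coe_ne_top ENNReal.ofReal_ne_top
    rw [penalized_eq_coe _ hfin, hc, ENNReal.toReal_ofReal (Finset.sum_nonneg fun i _ => sq_nonneg _)]
  simp only [← hval]
  refine le_antisymm (iSup_le fun ξ => ?_) (iSup_le fun x => le_iSup
    (fun ξ => penalized (weightedCost w) loss lam ξ z) (x, z.2))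
  by_cases h : ξ.2 = z.2
  · rw [show ξ = (ξ.1, z.2) from Prod.ext rfl h]
    exact le_iSup (fun x : X => penalized (weightedCost w) loss lam (x, z.2) z) ξ.1
  · have hc : weightedCost w ξ z = ∞ := by simp [weightedCost, h]
    rw [penalized, hc, ENNReal.mul_top (ENNReal.coe_ne_zero.2 hlam), EReal.coe_ennreal_top,
      EReal.sub_top]
    exact bot_le

/-- The supremum may be uncountable, so measurability comes from lower semicontinuity: once the
label is fixed, each competitor is continuous in `z`. -/
theorem measurable_surrogate_weightedCost (w : Fin m → ℝ) {loss : X × Y → ℝ}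
    (hl : Continuous loss) (lam : ℝ≥0) : Measurable (surrogate (weightedCost w) loss lam) := by
  unfold surrogate
  refine measurable_ereal_toReal.comp ?_
  rcases eq_or_ne lam 0 with rfl | hlam
  -- Since `0 * ∞ = 0`, the surrogate is constant here.
  · simp [penalized]
  · simp only [iSup_penalized_weightedCost w loss hlam]
    refine (lowerSemicontinuous_iSup fun x => Continuous.lowerSemicontinuous ?_).measurable
    exact continuous_coe_real_ereal.comp (by fun_prop)

end WeightedCost

end RobustRisk

/-! ### The guarantee. -/

theorem mainTheorem2 :
    ∃ k : ℝ, 0 ≤ k ∧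
      ∀ (m d n : ℕ) (_ : 0 < n)
        (X : Set (EuclideanSpace ℝ (Fin m))) (Y : Set ℝ)
        (w : Fin m → ℝ) (_ : ∀ i, 1 ≤ w i)
        (P₀ : Measure (X × Y)) (_ : IsProbabilityMeasure P₀)
        (ℓ : ℝ → ℝ → ℝ) (f : EuclideanSpace ℝ (Fin d) → X → ℝ) (F : Set (X → ℝ))
        (_ : ∀ θ, f θ ∈ F)
        (_ : Continuous fun q : EuclideanSpace ℝ (Fin d) × (X × Y) =>
          RobustRisk.predictionLoss ℓ (f q.1) q.2)
        (T : ℝ) (_ : 0 ≤ T)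
        (_ : ∀ (θ : EuclideanSpace ℝ (Fin d)) (z : X × Y),
          |RobustRisk.predictionLoss ℓ (f θ) z| ≤ T)
        (δ : ℝ) (_ : 0 < δ) (_ : δ < 1)
        (θ : EuclideanSpace ℝ (Fin d)) (lam : ℝ≥0),
        -- the bound at a prescribed radius
        (∀ ρ : ℝ≥0,
          RobustRisk.HoldsWithProb (Measure.pi fun _ : Fin n => P₀) (1 - δ)
            {z | RobustRisk.worstRisk (RobustRisk.weightedCost w)
                    (RobustRisk.predictionLoss ℓ (f θ)) ρ P₀
                  ≤ (((lam : ℝ) * ρ : ℝ) : EReal)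
                    + ((∫ ζ, RobustRisk.surrogate (RobustRisk.weightedCost w)
                        (RobustRisk.predictionLoss ℓ (f θ)) lam ζ
                        ∂(RobustRisk.empirical z) : ℝ) : EReal)
                    + (RobustRisk.rademacher P₀ n (RobustRisk.shiftedLossClass ℓ F) : EReal)
                    + ((k * T * √(Real.log (1 / δ) / n) : ℝ) : EReal)}) ∧
        -- the bound at the data-dependent radius given by a maximizer map `M`
        (∀ M : X × Y → X × Y,
          (∀ z₀ ξ : X × Y,
            RobustRisk.penalized (RobustRisk.weightedCost w)
                (RobustRisk.predictionLoss ℓ (f θ)) lam ξ z₀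
              ≤ RobustRisk.penalized (RobustRisk.weightedCost w)
                (RobustRisk.predictionLoss ℓ (f θ)) lam (M z₀) z₀) →
          RobustRisk.HoldsWithProb (Measure.pi fun _ : Fin n => P₀) (1 - δ)
            {z | RobustRisk.worstRisk (RobustRisk.weightedCost w)
                    (RobustRisk.predictionLoss ℓ (f θ))
                    (∫⁻ ζ, RobustRisk.weightedCost w (M ζ) ζ ∂(RobustRisk.empirical z)) P₀
                  ≤ RobustRisk.worstRisk (RobustRisk.weightedCost w)
                      (RobustRisk.predictionLoss ℓ (f θ))
                      (∫⁻ ζ, RobustRisk.weightedCost w (M ζ) ζ ∂(RobustRisk.empirical z))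
                      (RobustRisk.empirical z)
                    + (RobustRisk.rademacher P₀ n (RobustRisk.shiftedLossClass ℓ F) : EReal)
                    + ((k * T * √(Real.log (1 / δ) / n) : ℝ) : EReal)}) := by
  refine ⟨√2, Real.sqrt_nonneg _, ?_⟩
  intro m d n hn X Y w _ P₀ _ ℓ f F _ hcont T hT hbd δ hδ hδ1 θ lam
  have hl : Continuous (RobustRisk.predictionLoss (X := X) (Y := Y) ℓ (f θ)) :=
    hcont.comp (Continuous.prodMk_right θ)
  have hs := RobustRisk.measurable_surrogate_weightedCost w hl lam
  have hc := RobustRisk.weightedCost_self (X := X) (Y := Y) w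
  have hdual := RobustRisk.worstRisk_le hc (hbd θ) (RobustRisk.measurable_weightedCost w)
    hl.measurable hs P₀
  -- The event depends on neither `ρ` nor `M`, so it serves both claims, including the random
  -- radius.
  obtain ⟨S, hS, hsub, hprob⟩ := RobustRisk.holdsWithProb_integral_le_empirical (P := P₀) hs hT
    (RobustRisk.surrogate_mem_Icc hc (hbd θ) lam) hn hδ hδ1
  have hR : (0 : EReal) ≤ (RobustRisk.rademacher P₀ n (RobustRisk.shiftedLossClass ℓ F) : EReal) :=
    EReal.coe_ennreal_nonneg _
  refine ⟨fun ρ => ⟨S, hS, fun z hz => ?_, hprob⟩, fun M hM => ⟨S, hS, fun z hz => ?_, hprob⟩⟩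
  · refine (hdual ρ).trans ?_
    rw [add_right_comm]
    refine le_trans ?_ (le_add_of_nonneg_right hR)
    rw [← EReal.coe_add, ← EReal.coe_add, EReal.coe_le_coe_iff]
    have h := hsub hz
    rw [Set.mem_ofPred_eq] at h
    linarith
  · rw [Set.mem_ofPred_eq, add_right_comm]
    refine le_trans ?_ (le_add_of_nonneg_right hR)
    -- At infinite radius both balls contain every probability measure and the two worst-case risks
    -- coincide.
    by_cases hfin : ∫⁻ ζ, RobustRisk.weightedCost w (M ζ) ζ ∂(RobustRisk.empirical z) = ∞
    · rw [hfin, RobustRisk.worstRisk_top_eq _ _ P₀ (RobustRisk.empirical z)]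
      exact le_add_of_nonneg_right (EReal.coe_nonneg.2 (by positivity))
    · have hle := RobustRisk.le_worstRisk_empirical hn hc (hbd θ) M hM z hfin
      refine le_trans ?_ (add_le_add_left hle _)
      have hd := hdual (∫⁻ ζ, RobustRisk.weightedCost w (M ζ) ζ ∂(RobustRisk.empirical z)).toNNReal
      rw [ENNReal.coe_toNNReal hfin] at hd
      refine hd.trans ?_
      rw [← EReal.coe_add, EReal.coe_le_coe_iff]
      have h := hsub hz
      rw [Set.mem_ofPred_eq] at h
      rw [ENNReal.toReal]
      linarith
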